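/- Let $(G,d)$ be a finite metric graph, i.e. a length space (the distance between any two points is the infimum of the lengths of the continuous paths joining them; in particular $G$ is connected) that is homeomorphic to a finite topological graph (finitely many vertices and edges, loops and multiple edges allowed). Let $\beta_1(G)$ be its first Betti number, and let $\mathrm{hyp}(G)$ be its hyperbolicity, i.e. the least $\delta\ge 0$ such that $$d(x,y)+d(w,z)\le\max\bigl(d(x,w)+d(y,z),\,d(x,z)+d(y,w)\bigr)+2\delta\qquad\text{for all }x,y,z,w\in G .$$ For $p,x,x'\in G$ put $$g_p(x,x')=\tfrac12\bigl(d(p,x)+d(p,x')-d(x,x')\bigr),\qquad g_p^\infty(x,x')=\sup_{x=x_0,x_1,\dots,x_n=x'}\ \min_{1\le i\le n} g_p(x_{i-1},x_i),$$ where the supremum is over all finite chains of points of $G$ ($n\ge1$), and $$t_p(x,x')=d(p,x)+d(p,x')-2\,g_p^\infty(x,x').$$ Then $t_p$ is a pseudo-metric on $G$; let $\mathrm T_pG$ be the metric space associated to it (points at $t_p$-distance $0$ are identified). For every $p\in G$, $$\|d-t_p\|_\infty=\sup_{x,x'\in G}|d(x,x')-t_p(x,x')|\ \le\ 2\,\log_2\bigl(4\beta_1(G)+4\bigr)\,\mathrm{hyp}(G),$$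 and in particular, for the Gromov–Hausdorff distance, $$d_{\mathrm{GH}}(G,\mathrm T_pG)\ \le\ \log_2\bigl(4\beta_1(G)+4\bigr)\,\mathrm{hyp}(G).$$ -/

import Mathlib

universe u

noncomputable section

/-! ### Finite metric graphs -/

/-- A length space: the distance between two points is the infimum of the lengths of the continuous
paths joining them. The length of a path is its total variation. As distances are finite, any two
points are joined by a path of finite length. -/
class IsLengthSpace (X : Type u) [MetricSpace X] : Prop where
  edist_eq_iInf_length : ∀ x y : X,
    edist x y = ⨅ γ : Path x y, eVariationOn (fun t : unitInterval => γ t) Set.univ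

/-- The structure of a finite topological graph (finite CW complex of dimension at most one) on a
Hausdorff space `X`: finitely many vertices, and finitely many edges given by characteristic maps
`[0,1] → X` that send the endpoints to vertices and are injective on the open interval, such that
`X` is the disjoint union of the vertices and of the open edges.
Loops and multiple edges are allowed. (In a Hausdorff space the topology is then automatically the
quotient topology, so that `X` is homeomorphic to the geometric realization of the graph.) -/
class FiniteTopologicalGraph (X : Type u) [TopologicalSpace X] where
  /-- the vertices -/
  vertices : Finset X
  /-- the index type of the edges -/
  Edge : Type
  finite_edge : Finite Edge
  /-- the characteristic maps of the edges -/
  edge : Edge → C(unitInterval, X)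
  edge_zero_mem : ∀ e, edge e 0 ∈ vertices
  edge_one_mem : ∀ e, edge e 1 ∈ vertices
  edge_notMem : ∀ e, ∀ s ∈ Set.Ioo (0 : unitInterval) 1, edge e s ∉ vertices
  edge_inj : ∀ e e', ∀ s ∈ Set.Ioo (0 : unitInterval) 1, ∀ t ∈ Set.Ioo (0 : unitInterval) 1,
    edge e s = edge e' t → e = e' ∧ s = t
  cover : ∀ x : X, x ∈ vertices ∨ ∃ e, ∃ s ∈ Set.Ioo (0 : unitInterval) 1, edge e s = x

namespace FiniteTopologicalGraph

variable (X : Type u) [TopologicalSpace X] [FiniteTopologicalGraph X]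

instance compactSpace : CompactSpace X := by
  have : Finite (Edge X) := finite_edge
  have h : (Set.univ : Set X) =
      (↑(vertices : Finset X) : Set X) ∪ ⋃ e : Edge X, Set.range (edge e) := by
    ext x
    rcases cover x with hx | ⟨e, s, _, rfl⟩
    · simp [hx]
    · simp only [Set.mem_univ, Set.mem_union, Set.mem_iUnion, true_iff]
      exact Or.inr ⟨e, s, rfl⟩
  refine ⟨?_⟩
  rw [h]
  exact (Finset.finite_toSet _).isCompact.union
    (isCompact_iUnion fun e => isCompact_range (edge e).continuous)

/-- The boundary map `∂ : C₁ → C₀` of the cellular chain complex with rational coefficients: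
an edge is sent to its final vertex minus its initial vertex. -/
def boundary : (Edge X →₀ ℚ) →ₗ[ℚ] ({v : X // v ∈ (vertices : Finset X)} →₀ ℚ) :=
  Finsupp.linearCombination ℚ fun e : Edge X =>
    (Finsupp.single ⟨edge e 1, edge_one_mem e⟩ 1 - Finsupp.single ⟨edge e 0, edge_zero_mem e⟩ 1)

/-- The first Betti number `β₁ = dim H₁`. As a graph has no cells of dimension two, the first
homology group of its cellular chain complex `0 → C₁ → C₀ → 0` is the kernel of `∂`. -/
def firstBetti : ℕ := Module.finrank ℚ (LinearMap.ker (boundary X))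

end FiniteTopologicalGraph

/-! ### Hyperbolicity -/

/-- `δ`-hyperbolicity (four point condition). -/
def IsGromovHyperbolic (X : Type u) [MetricSpace X] (δ : ℝ) : Prop :=
  ∀ x y z w : X,
    dist x y + dist w z ≤ max (dist x w + dist y z) (dist x z + dist y w) + 2 * δ

/-- The hyperbolicity of a (bounded) metric space: the least `δ ≥ 0` for which the space is
`δ`-hyperbolic. -/
def hyperbolicity (X : Type u) [MetricSpace X] : ℝ :=
  sInf {δ : ℝ | 0 ≤ δ ∧ IsGromovHyperbolic X δ}

/-! ### The Gromov tree metric -/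

section GromovTree

variable {X : Type u} [MetricSpace X]

/-- The Gromov product `g_p(x, y)`. -/
def gromovProduct (p x y : X) : ℝ := (dist p x + dist p y - dist x y) / 2

/-- `g_p^∞(x, y)`: the supremum, over all finite chains `x = c 0, c 1, …, c (n + 1) = y`, of the
minimum of the Gromov products of consecutive points. -/
def gromovProductInf (p x y : X) : ℝ :=
  sSup {r : ℝ | ∃ (n : ℕ) (c : ℕ → X), c 0 = x ∧ c (n + 1) = y ∧
    r = (Finset.range (n + 1)).inf' Finset.nonempty_range_add_one
      fun i => gromovProduct p (c i) (c (i + 1))}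

/-- The Gromov tree (pseudo-)metric `t_p`. -/
def gromovTreeDist (p x y : X) : ℝ := dist p x + dist p y - 2 * gromovProductInf p x y

theorem gromovProduct_le_left (p x y : X) : gromovProduct p x y ≤ dist p x := by
  have := dist_triangle p x y
  unfold gromovProduct
  linarith

theorem gromovProduct_comm (p x y : X) : gromovProduct p x y = gromovProduct p y x := by
  unfold gromovProduct
  rw [dist_comm x y]
  ring

theorem gromovProduct_self (p x : X) : gromovProduct p x x = dist p x := by
  simp [gromovProduct]

theorem bddAbove_gromovProductInf (p x y : X) :
    BddAbove {r : ℝ | ∃ (n : ℕ) (c : ℕ → X), c 0 = x ∧ c (n + 1) = y ∧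
      r = (Finset.range (n + 1)).inf' Finset.nonempty_range_add_one
        fun i => gromovProduct p (c i) (c (i + 1))} := by
  refine ⟨dist p x, ?_⟩
  rintro r ⟨n, c, h0, -, rfl⟩
  refine (Finset.inf'_le _ (Finset.mem_range.2 (Nat.succ_pos n))).trans ?_
  rw [← h0]
  exact gromovProduct_le_left _ _ _

theorem gromovProduct_mem_chains (p x y : X) :
    gromovProduct p x y ∈ {r : ℝ | ∃ (n : ℕ) (c : ℕ → X), c 0 = x ∧ c (n + 1) = y ∧
      r = (Finset.range (n + 1)).inf' Finset.nonempty_range_add_one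
        fun i => gromovProduct p (c i) (c (i + 1))} :=
  ⟨0, fun i => if i = 0 then x else y, by simp, by simp, by simp⟩

theorem gromovProduct_le_inf (p x y : X) : gromovProduct p x y ≤ gromovProductInf p x y :=
  le_csSup (bddAbove_gromovProductInf p x y) (gromovProduct_mem_chains p x y)

theorem gromovProductInf_le_left (p x y : X) : gromovProductInf p x y ≤ dist p x := by
  refine csSup_le ⟨_, gromovProduct_mem_chains p x y⟩ ?_
  rintro r ⟨n, c, h0, -, rfl⟩
  refine (Finset.inf'_le _ (Finset.mem_range.2 (Nat.succ_pos n))).trans ?_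
  rw [← h0]
  exact gromovProduct_le_left _ _ _

theorem lt_gromovProductInf_iff (p x y : X) (t : ℝ) :
    t < gromovProductInf p x y ↔
      Relation.TransGen (fun a b => t < gromovProduct p a b) x y := by
  constructor
  · intro h
    obtain ⟨r, ⟨n, c, h0, h1, rfl⟩, hr⟩ :=
      exists_lt_of_lt_csSup ⟨_, gromovProduct_mem_chains p x y⟩ h
    rw [Finset.lt_inf'_iff] at hr
    have key : ∀ m, m ≤ n →
        Relation.TransGen (fun a b => t < gromovProduct p a b) (c 0) (c (m + 1)) := by
      intro m
      induction m with
      | zero => exact fun _ => .single (hr 0 (by simp))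
      | succ m ih =>
        exact fun hm => (ih (by omega)).tail (hr (m + 1) (by simp; omega))
    have := key n le_rfl
    rwa [h0, h1] at this
  · intro h
    have key : ∃ (n : ℕ) (c : ℕ → X), c 0 = x ∧ c (n + 1) = y ∧
        ∀ i < n + 1, t < gromovProduct p (c i) (c (i + 1)) := by
      induction h with
      | single hxy =>
        exact ⟨0, fun i => if i = 0 then x else _, by simp, by simp; rfl, by simpa using hxy⟩
      | @tail b z _ hbz ih =>
        obtain ⟨n, c, h0, h1, hc⟩ := ih
        refine ⟨n + 1, fun i => if i ≤ n + 1 then c i else z, by simpa using h0, by simp, ?_⟩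
        intro i hi
        rcases Nat.lt_or_ge i (n + 1) with hi' | hi'
        · have h2 : i ≤ n + 1 := by omega
          have h3 : i + 1 ≤ n + 1 := by omega
          simp only [h2, h3, if_true]
          exact hc i hi'
        · obtain rfl : i = n + 1 := by omega
          simpa [h1] using hbz
    obtain ⟨n, c, h0, h1, hc⟩ := key
    refine lt_of_lt_of_le ?_ (le_csSup (bddAbove_gromovProductInf p x y) ⟨n, c, h0, h1, rfl⟩)
    rw [Finset.lt_inf'_iff]
    exact fun i hi => hc i (Finset.mem_range.1 hi)

theorem gromovProductInf_comm (p x y : X) :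
    gromovProductInf p x y = gromovProductInf p y x := by
  refine eq_of_forall_lt_iff fun t => ?_
  rw [lt_gromovProductInf_iff, lt_gromovProductInf_iff, ← Relation.transGen_swap]
  have : Function.swap (fun a b => t < gromovProduct p a b) =
      fun a b => t < gromovProduct p a b := by
    funext a b
    simp only [Function.swap, gromovProduct_comm p b a]
  rw [this]

theorem min_le_gromovProductInf (p x y z : X) :
    min (gromovProductInf p x y) (gromovProductInf p y z) ≤ gromovProductInf p x z := by
  refine le_of_forall_lt fun t ht => ?_
  rw [lt_min_iff, lt_gromovProductInf_iff, lt_gromovProductInf_iff] at ht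
  exact (lt_gromovProductInf_iff p x z t).2 (ht.1.trans ht.2)

/-- A copy of `X`, carrying the pseudo-metric `t_p`. -/
def GromovTreePre (_p : X) : Type u := X

/-- The space `X` with the pseudo-metric `t_p`. -/
instance GromovTreePre.pseudoMetricSpace (p : X) : PseudoMetricSpace (GromovTreePre p) where
  dist x y := gromovTreeDist (X := X) p x y
  dist_self x := by
    have h1 := gromovProductInf_le_left (X := X) p x x
    have h2 := gromovProduct_le_inf (X := X) p x x
    have h3 := gromovProduct_self (X := X) p x
    change dist (α := X) p x + dist (α := X) p x - 2 * gromovProductInf (X := X) p x x = 0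
    linarith
  dist_comm x y := by
    change dist (α := X) p x + dist (α := X) p y - 2 * gromovProductInf (X := X) p x y =
      dist (α := X) p y + dist (α := X) p x - 2 * gromovProductInf (X := X) p y x
    rw [gromovProductInf_comm (X := X) p x y]
    ring
  dist_triangle x y z := by
    have h1 := gromovProductInf_le_left (X := X) p y z
    have h2 := gromovProductInf_le_left (X := X) p y x
    rw [gromovProductInf_comm (X := X) p y x] at h2
    have h3 := min_le_gromovProductInf (X := X) p x y z
    change dist (α := X) p x + dist (α := X) p z - 2 * gromovProductInf (X := X) p x z ≤
      (dist (α := X) p x + dist (α := X) p y - 2 * gromovProductInf (X := X) p x y) +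
      (dist (α := X) p y + dist (α := X) p z - 2 * gromovProductInf (X := X) p y z)
    rcases min_le_iff.1 h3 with h | h <;> linarith

/-- The Gromov tree `T_p X`: the metric space associated to the pseudo-metric `t_p` on `X`, i.e.
the quotient by the relation `t_p(x, y) = 0`, with the induced metric. -/
def GromovTree (p : X) : Type u := SeparationQuotient (GromovTreePre p)

instance GromovTree.metricSpace (p : X) : MetricSpace (GromovTree p) :=
  inferInstanceAs (MetricSpace (SeparationQuotient (GromovTreePre p)))

/-- The quotient map `X → T_p X`. -/
def GromovTree.mk (p : X) (x : X) : GromovTree p :=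
  SeparationQuotient.mk (X := GromovTreePre p) x

theorem GromovTree.dist_mk (p x y : X) :
    dist (GromovTree.mk p x) (GromovTree.mk p y) = gromovTreeDist p x y := rfl

theorem GromovTree.mk_surjective (p : X) : Function.Surjective (GromovTree.mk p) :=
  SeparationQuotient.surjective_mk (X := GromovTreePre p)

theorem GromovTree.continuous_mk (p : X) : Continuous (GromovTree.mk p) := by
  refine (LipschitzWith.mk_one fun x y => ?_).continuous
  rw [GromovTree.dist_mk]
  have := gromovProduct_le_inf p x y
  unfold gromovProduct at this
  unfold gromovTreeDist
  linarith

instance GromovTree.nonempty (p : X) : Nonempty (GromovTree p) := ⟨GromovTree.mk p p⟩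

instance GromovTree.compactSpace [CompactSpace X] (p : X) : CompactSpace (GromovTree p) :=
  (GromovTree.mk_surjective p).compactSpace (GromovTree.continuous_mk p)

end GromovTree

end

/-! ### Geodesics in compact length spaces -/

section Geodesics

/-! Since `d - t_p = 2 (g_p^∞ - g_p)` and this is nonnegative, everything reduces to bounding `g_p^∞
- g_p`. Hyperbolicity lets the Gromov product drop by at most `δ` when two chains are concatenated,
so by halving, a chain of at most `2 ^ k` steps loses at most `k δ`
(`IsGromovHyperbolic.le_gromovProduct_of_chain`). What is needed is a bound on the length of
efficient chains.

That bound is `chain_length_le`. In a chain that cannot be shortened, the geodesics from `p` to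
non-consecutive points have already separated at a height `T` slightly above `t`, whereas
consecutive points are joined above height `T`. Removing the points at height `T` on every second
geodesic therefore leaves both sides of each removed point in the component of `p`. A graph can be
cut at no more than `β₁` such points (`card_le_firstBetti_of_isPreconnected`), so a minimal chain
has at most `2 β₁ + 1` steps.

The Gromov–Hausdorff bound follows because the quotient map to the tree is onto, and the distance is
at most half its distortion. -/

theorem continuousOn_of_dist_eq_abs {X : Type u} [MetricSpace X] {σ : ℝ → X} {s : Set ℝ}
    (h : ∀ a ∈ s, ∀ b ∈ s, dist (σ a) (σ b) = |a - b|) : ContinuousOn σ s :=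
  (LipschitzOnWith.of_dist_le_mul (K := 1) fun a ha b hb => by
    rw [h a ha b hb, Real.dist_eq]; simp).continuousOn

variable {X : Type u} [MetricSpace X] [IsLengthSpace X]

theorem IsLengthSpace.exists_path_length_lt (x y : X) {ε : ℝ} (hε : 0 < ε) :
    ∃ γ : Path x y, eVariationOn (fun t : unitInterval => γ t) Set.univ <
      ENNReal.ofReal (dist x y + ε) := by
  have h := IsLengthSpace.edist_eq_iInf_length x y
  rw [edist_dist] at h
  rw [← iInf_lt_iff, ← h]
  exact (ENNReal.ofReal_lt_ofReal_iff (by positivity)).2 (by linarith)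

/-- On a nearly shortest path, the intermediate value theorem gives a point at distance `s` from
`x`; additivity of length bounds the remaining distance. -/
theorem IsLengthSpace.exists_approx_between (x y : X) {s ε : ℝ} (hs : 0 ≤ s)
    (hs' : s ≤ dist x y) (hε : 0 < ε) :
    ∃ m : X, dist x m = s ∧ dist m y ≤ dist x y - s + ε := by
  obtain ⟨γ, hγ⟩ := exists_path_length_lt x y hε
  have hcont : Continuous fun t : unitInterval => dist x (γ t) := by fun_prop
  obtain ⟨t, ht⟩ : s ∈ Set.range fun t : unitInterval => dist x (γ t) :=
    intermediate_value_univ 0 1 hcont ⟨by simpa using hs, by simpa using hs'⟩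
  refine ⟨γ t, ht, ?_⟩
  have h1 := eVariationOn.add_le_union (fun t : unitInterval => γ t)
    (s := Set.Iic t) (t := Set.Ici t) fun a ha b hb => le_trans ha hb
  rw [Set.Iic_union_Ici] at h1
  have h2 := eVariationOn.edist_le (fun t : unitInterval => γ t)
    (s := Set.Iic t) (x := 0) (y := t) (by simp) (by simp)
  have h3 := eVariationOn.edist_le (fun t : unitInterval => γ t)
    (s := Set.Ici t) (x := t) (y := 1) (by simp) (Set.mem_Ici.2 unitInterval.le_one')
  have h4 := ((add_le_add h2 h3).trans h1).trans_lt hγ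
  simp only [Path.source, Path.target] at h4
  rw [edist_dist, edist_dist, ← ENNReal.ofReal_add dist_nonneg dist_nonneg] at h4
  have h5 := (ENNReal.ofReal_lt_ofReal_iff_of_nonneg (by positivity)).1 h4
  have ht' : dist x (γ t) = s := ht
  linarith

variable [CompactSpace X]

/-- By compactness the distance to `y` attains its minimum on the sphere of radius `s` around `x`,
and approximate midpoints force the minimum down to `dist x y - s`. -/
theorem IsLengthSpace.exists_between (x y : X) {s : ℝ} (hs : 0 ≤ s) (hs' : s ≤ dist x y) :
    ∃ m : X, dist x m = s ∧ dist m y = dist x y - s := by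
  have hne : {m : X | dist x m = s}.Nonempty :=
    (exists_approx_between x y hs hs' one_pos).imp fun _ h => h.1
  have hcl : IsClosed {m : X | dist x m = s} := isClosed_eq (by fun_prop) (by fun_prop)
  obtain ⟨m, hm, hmin⟩ := hcl.isCompact.exists_isMinOn hne
    (f := fun m => dist m y) (by fun_prop)
  refine ⟨m, hm, le_antisymm (le_of_forall_pos_le_add fun ε hε => ?_) ?_⟩
  · obtain ⟨m', h1, h2⟩ := exists_approx_between x y hs hs' hε
    exact (hmin h1).trans h2
  · have := dist_triangle x m y
    have hm' : dist x m = s := hm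
    linarith

/-- Geodesics exist in compact length spaces. -/
theorem IsLengthSpace.exists_geodesic (p x : X) :
    ∃ σ : ℝ → X, σ 0 = p ∧ σ (dist p x) = x ∧
      ∀ a ∈ Set.Icc 0 (dist p x), ∀ b ∈ Set.Icc 0 (dist p x), dist (σ a) (σ b) = |a - b| := by
  -- A geodesic is obtained as a maximal set on which the distance from `p` is an isometric
  -- coordinate. Maximality makes it closed, and then without gaps.
  let S : Set (Set X) := {M | (∀ a ∈ M, dist p a ≤ dist p x) ∧
    ∀ a ∈ M, ∀ b ∈ M, dist a b = |dist p a - dist p b|}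
  have h0 : ({p, x} : Set X) ∈ S := by
    refine ⟨by simp, ?_⟩
    simp [dist_comm x p]
  obtain ⟨M, h0M, hMmax⟩ := zorn_subset_nonempty S (by
    intro c hcS hc hne
    refine ⟨⋃₀ c, ⟨?_, ?_⟩, fun s hs => Set.subset_sUnion_of_mem hs⟩
    · rintro a ⟨s, hs, ha⟩
      exact (hcS hs).1 a ha
    · rintro a ⟨s, hs, ha⟩ b ⟨s', hs', hb⟩
      rcases hc.total hs hs' with h | h
      · exact (hcS hs').2 a (h ha) b hb
      · exact (hcS hs).2 a ha b (h hb)) {p, x} h0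
  obtain ⟨hM1, hM2⟩ := hMmax.prop
  have hclS : closure M ∈ S := by
    constructor
    · exact fun a ha => closure_minimal (t := {a | dist p a ≤ dist p x}) hM1
        (isClosed_le (by fun_prop) (by fun_prop)) ha
    · intro a ha b hb
      have := (isClosed_eq (f := fun q : X × X => dist q.1 q.2)
        (g := fun q : X × X => |dist p q.1 - dist p q.2|) (by fun_prop) (by fun_prop))
      exact closure_minimal (s := M ×ˢ M) (fun q hq => hM2 _ hq.1 _ hq.2) this
        (by rw [closure_prod_eq]; exact ⟨ha, hb⟩ : (a, b) ∈ closure (M ×ˢ M))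
  have hMcl : IsClosed M :=
    isClosed_of_closure_subset (hMmax.le_of_ge hclS subset_closure)
  have hpM : p ∈ M := h0M (by simp)
  have hxM : x ∈ M := h0M (by simp)
  have hsurj : ∀ r ∈ Set.Icc 0 (dist p x), ∃ a ∈ M, dist p a = r := by
    intro r hr
    -- `a` and `b` are the points of `M` nearest to level `r` from below and from above. A point
    -- between them at level `r` is compatible with all of `M`, hence lies in `M` by maximality.
    obtain ⟨a, ⟨haM, har⟩, hamax⟩ := (hMcl.inter (isClosed_le (f := fun a => dist p a)
      (g := fun _ => r) (by fun_prop) (by fun_prop))).isCompact.exists_isMaxOn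
      ⟨p, hpM, by simpa using hr.1⟩ (f := fun a => dist p a) (by fun_prop)
    obtain ⟨b, ⟨hbM, hbr⟩, hbmin⟩ := (hMcl.inter (isClosed_le (f := fun _ => r)
      (g := fun a => dist p a) (by fun_prop) (by fun_prop))).isCompact.exists_isMinOn
      ⟨x, hxM, hr.2⟩ (f := fun a => dist p a) (by fun_prop)
    have har' : dist p a ≤ r := har
    have hbr' : r ≤ dist p b := hbr
    have hab : dist a b = dist p b - dist p a := by
      rw [hM2 a haM b hbM, abs_sub_comm, abs_of_nonneg (by linarith)]
    obtain ⟨m, hm1, hm2⟩ := exists_between a b (s := r - dist p a) (by linarith) (by linarith)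
    have hm : dist p m = r := by
      have t1 := dist_triangle p a m
      have t2 := dist_triangle p m b
      linarith
    have hdist : ∀ w ∈ M, dist m w = |dist p m - dist p w| := by
      intro w hw
      rw [hm]
      rcases le_total (dist p w) r with h | h
      · have h1 : dist p w ≤ dist p a := hamax ⟨hw, h⟩
        have h2 := hM2 w hw a haM
        rw [abs_sub_comm, abs_of_nonneg (by linarith)] at h2
        have t1 := dist_triangle w a m
        have t2 := dist_triangle p w m
        rw [abs_of_nonneg (by linarith), dist_comm]
        linarith
      · have h1 : dist p b ≤ dist p w := hbmin ⟨hw, h⟩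
        have h2 := hM2 b hbM w hw
        rw [abs_sub_comm, abs_of_nonneg (by linarith)] at h2
        have t1 := dist_triangle m b w
        have t2 := dist_triangle p m w
        rw [abs_sub_comm, abs_of_nonneg (by linarith)]
        linarith
    have hins : insert m M ∈ S := by
      constructor
      · rintro w (rfl | hw)
        · rw [hm]; exact hr.2
        · exact hM1 w hw
      · rintro w (rfl | hw) w' (rfl | hw')
        · simp
        · exact hdist _ hw'
        · rw [dist_comm, abs_sub_comm]; exact hdist _ hw
        · exact hM2 _ hw _ hw'
    exact ⟨m, hMmax.le_of_ge hins (Set.subset_insert _ _) (Set.mem_insert _ _), hm⟩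
  have : Nonempty X := ⟨p⟩
  choose! σ hσM hσ using hsurj
  have key : ∀ a ∈ Set.Icc 0 (dist p x), ∀ b ∈ Set.Icc 0 (dist p x),
      dist (σ a) (σ b) = |a - b| := by
    intro a ha b hb
    rw [hM2 _ (hσM a ha) _ (hσM b hb), hσ a ha, hσ b hb]
  have m0 : (0 : ℝ) ∈ Set.Icc 0 (dist p x) := ⟨le_rfl, dist_nonneg⟩
  have m1 : dist p x ∈ Set.Icc 0 (dist p x) := ⟨dist_nonneg, le_rfl⟩
  refine ⟨σ, ?_, ?_, key⟩
  · exact (dist_eq_zero.1 (hσ 0 m0)).symm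
  · have := hM2 _ (hσM _ m1) _ hxM
    rw [hσ _ m1, sub_self, abs_zero] at this
    exact dist_eq_zero.1 this

end Geodesics

/-! ### Cutting a graph without disconnecting it -/

namespace FiniteTopologicalGraph

section LinearAlgebra

variable (X : Type u) [TopologicalSpace X] [FiniteTopologicalGraph X]

/-- If the boundary of each edge of `F` is the boundary of a chain of edges outside `F`, then `F`
has at most `β₁` elements. -/
theorem ncard_le_firstBetti (F : Set (Edge X))
    (hF : ∀ f ∈ F, boundary X (Finsupp.single f 1) ∈
      (Finsupp.supported ℚ ℚ Fᶜ).map (boundary X)) :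
    F.ncard ≤ firstBetti X := by
  have : Finite (Edge X) := finite_edge
  classical
  have : Fintype F := Fintype.ofFinite F
  -- Subtracting the replacing chain from `f` gives a cycle whose coordinates on `F` are those of
  -- `f` alone; such cycles are linearly independent.
  have hz : ∀ f : F, ∃ z : LinearMap.ker (boundary X),
      ∀ g : F, (z : Edge X →₀ ℚ) g = if f = g then 1 else 0 := by
    intro f
    obtain ⟨c, hc, hbc⟩ := hF f f.2
    refine ⟨⟨Finsupp.single (f : Edge X) 1 - c, ?_⟩, fun g => ?_⟩
    · rw [LinearMap.mem_ker, map_sub, hbc, sub_self]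
    · have hcg : c (g : Edge X) = 0 := by
        by_contra h
        exact hc (Finsupp.mem_support_iff.2 h) g.2
      simp [Finsupp.single_apply, hcg, Subtype.ext_iff]
  choose z hz using hz
  have hli : LinearIndependent ℚ z := by
    rw [Fintype.linearIndependent_iff]
    intro a ha g
    have h1 := congrArg (fun w : LinearMap.ker (boundary X) => (w : Edge X →₀ ℚ) g) ha
    simpa [Finsupp.finsetSum_apply, hz] using h1
  rw [← Nat.card_coe_set_eq, Nat.card_eq_fintype_card]
  exact hli.fintype_card_le_finrank

end LinearAlgebra

/-! ### Stars of vertices in a cut graph -/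

section Topology

variable {X : Type u} [TopologicalSpace X] [FiniteTopologicalGraph X]

theorem edge_eq_edge_iff {e e' : Edge X} {s t : unitInterval} (hs : s ∈ Set.Ioo 0 1)
    (h : edge e s = edge e' t) : e = e' ∧ s = t := by
  have ht : t ∈ Set.Ioo (0 : unitInterval) 1 := by
    refine ⟨lt_of_le_of_ne t.2.1 ?_, lt_of_le_of_ne t.2.2 ?_⟩
    · rintro rfl
      exact edge_notMem e s hs (h ▸ edge_zero_mem e')
    · rintro rfl
      exact edge_notMem e s hs (h ▸ edge_one_mem e')
  exact edge_inj e e' s hs t ht h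

/-- Open subintervals of edges are open. -/
theorem isOpen_image_edge [T2Space X] (e : Edge X) (a b : unitInterval) :
    IsOpen (edge e '' Set.Ioo a b) := by
  have : Finite (Edge X) := finite_edge
  have hI : ∀ {s : unitInterval}, s ∈ Set.Ioo a b → s ∈ Set.Ioo (0 : unitInterval) 1 :=
    fun h => ⟨lt_of_le_of_lt unitInterval.nonneg' h.1, lt_of_lt_of_le h.2 unitInterval.le_one'⟩
  -- The complement is a finite union of compact sets, closed since the space is Hausdorff.
  have h : (edge e '' Set.Ioo a b)ᶜ = (↑(vertices : Finset X) : Set X) ∪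
      ((⋃ e' ∈ ({e}ᶜ : Set (Edge X)), Set.range (edge e')) ∪
        edge e '' (Set.Iic a ∪ Set.Ici b)) := by
    ext x
    constructor
    · intro hx
      rcases cover x with hv | ⟨e', s, hs, rfl⟩
      · exact Or.inl hv
      · refine Or.inr ?_
        by_cases he : e' = e
        · subst he
          refine Or.inr ⟨s, ?_, rfl⟩
          by_contra hcon
          simp only [Set.mem_union, Set.mem_Iic, Set.mem_Ici, not_or, not_le] at hcon
          exact hx ⟨s, hcon, rfl⟩
        · exact Or.inl (Set.mem_biUnion (x := e') (by simpa using he) ⟨s, rfl⟩)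
    · rintro hx ⟨s, hs, rfl⟩
      rcases hx with hv | hx | ⟨t, ht, hx⟩
      · exact edge_notMem e s (hI hs) hv
      · simp only [Set.mem_iUnion] at hx
        obtain ⟨e', he', t, ht⟩ := hx
        exact he' (edge_eq_edge_iff (hI hs) ht.symm).1.symm
      · obtain ⟨-, rfl⟩ := edge_eq_edge_iff (hI hs) hx.symm
        rcases ht with ht | ht
        · exact absurd hs.1 (not_lt.2 ht)
        · exact absurd hs.2 (not_lt.2 ht)
  rw [← isClosed_compl_iff, h]
  refine ((Finset.finite_toSet _).isClosed).union (IsClosed.union ?_ ?_)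
  · exact (Set.toFinite _).isClosed_biUnion fun e' _ =>
      (isCompact_range (edge e').continuous).isClosed
  · exact ((isClosed_Iic.union isClosed_Ici).isCompact.image (edge e).continuous).isClosed

/-- Cut each edge `f` at the point with parameter `r f`. The points that lie in the star of a vertex
satisfying `P`. -/
def starUnion (r : Edge X → unitInterval) (P : X → Prop) : Set X :=
  {x | x ∈ (vertices : Finset X) ∧ P x} ∪
    ((⋃ f ∈ {f : Edge X | P (edge f 0)}, edge f '' Set.Iic (r f)) ∪
      ⋃ f ∈ {f : Edge X | P (edge f 1)}, edge f '' Set.Ici (r f))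

theorem isClosed_starUnion [T2Space X] (r : Edge X → unitInterval) (P : X → Prop) :
    IsClosed (starUnion r P) := by
  have : Finite (Edge X) := finite_edge
  refine ((Finset.finite_toSet (vertices : Finset X)).subset fun x hx => hx.1).isClosed.union
    (IsClosed.union ?_ ?_)
  · exact (Set.toFinite _).isClosed_biUnion fun f _ =>
      (isClosed_Iic.isCompact.image (edge f).continuous).isClosed
  · exact (Set.toFinite _).isClosed_biUnion fun f _ =>
      (isClosed_Ici.isCompact.image (edge f).continuous).isClosed

theorem edge_mem_starUnion_left {r : Edge X → unitInterval} {P : X → Prop} {f : Edge X}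
    {s : unitInterval} (hP : P (edge f 0)) (hs : s ≤ r f) : edge f s ∈ starUnion r P :=
  Or.inr (Or.inl (Set.mem_biUnion (x := f) hP ⟨s, hs, rfl⟩))

theorem edge_mem_starUnion_right {r : Edge X → unitInterval} {P : X → Prop} {f : Edge X}
    {s : unitInterval} (hP : P (edge f 1)) (hs : r f ≤ s) : edge f s ∈ starUnion r P :=
  Or.inr (Or.inr (Set.mem_biUnion (x := f) hP ⟨s, hs, rfl⟩))

theorem starUnion_union_not (r : Edge X → unitInterval) (P : X → Prop) :
    starUnion r P ∪ starUnion r (fun v => ¬ P v) = Set.univ := by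
  refine Set.eq_univ_of_forall fun x => ?_
  rcases cover x with hx | ⟨f, s, -, rfl⟩
  · by_cases h : P x
    · exact Or.inl (Or.inl ⟨hx, h⟩)
    · exact Or.inr (Or.inl ⟨hx, h⟩)
  · rcases le_total s (r f) with hs | hs
    · by_cases h : P (edge f 0)
      · exact Or.inl (edge_mem_starUnion_left h hs)
      · exact Or.inr (edge_mem_starUnion_left (P := fun v => ¬ P v) h hs)
    · by_cases h : P (edge f 1)
      · exact Or.inl (edge_mem_starUnion_right h hs)
      · exact Or.inr (edge_mem_starUnion_right (P := fun v => ¬ P v) h hs)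

/-- As `r f` is interior, a half-edge contains no vertex other than its own end. -/
theorem of_mem_starUnion_vertex {r : Edge X → unitInterval} (hr : ∀ f, r f ∈ Set.Ioo 0 1)
    {P : X → Prop} {x : X} (hx : x ∈ (vertices : Finset X)) (h : x ∈ starUnion r P) : P x := by
  rcases h with h | h | h
  · exact h.2
  · simp only [Set.mem_iUnion] at h
    obtain ⟨f, hP, s, hs, rfl⟩ := h
    have h0 : s = 0 := by
      by_contra h0
      exact edge_notMem f s ⟨unitInterval.pos_iff_ne_zero.2 h0, lt_of_le_of_lt hs (hr f).2⟩ hx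
    rw [h0]
    exact hP
  · simp only [Set.mem_iUnion] at h
    obtain ⟨f, hP, s, hs, rfl⟩ := h
    have h1 : s = 1 := by
      by_contra h1
      exact edge_notMem f s ⟨lt_of_lt_of_le (hr f).1 hs, unitInterval.lt_one_iff_ne_one.2 h1⟩ hx
    rw [h1]
    exact hP

/-- Used for `P` and for its negation together: inside an edge the two stars can overlap only at the
cut point, unless the ends of the edge differ in `P` there is no overlap at all. -/
theorem of_mem_starUnion_edge {r : Edge X → unitInterval} {P : X → Prop} {f : Edge X}
    {s : unitInterval} (hs : s ∈ Set.Ioo 0 1) (h : edge f s ∈ starUnion r P) :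
    (P (edge f 0) ∧ s ≤ r f) ∨ (P (edge f 1) ∧ r f ≤ s) := by
  rcases h with h | h | h
  · exact absurd h.1 (edge_notMem f s hs)
  · simp only [Set.mem_iUnion] at h
    obtain ⟨g, hP, t, ht, h⟩ := h
    obtain ⟨rfl, rfl⟩ := edge_eq_edge_iff hs h.symm
    exact Or.inl ⟨hP, ht⟩
  · simp only [Set.mem_iUnion] at h
    obtain ⟨g, hP, t, ht, h⟩ := h
    obtain ⟨rfl, rfl⟩ := edge_eq_edge_iff hs h.symm
    exact Or.inr ⟨hP, ht⟩

theorem boundary_single (f : Edge X) : boundary X (Finsupp.single f 1) =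
    Finsupp.single ⟨edge f 1, edge_one_mem f⟩ 1 - Finsupp.single ⟨edge f 0, edge_zero_mem f⟩ 1 := by
  simp [boundary]

/-- If a connected set avoids one interior point on each edge of `F`, and meets these edges on both
sides of the point, then `F` has at most `β₁` elements. -/
theorem ncard_le_firstBetti_of_isPreconnected [T2Space X] (F : Set (Edge X)) (r : Edge X → unitInterval)
    (hr : ∀ f, r f ∈ Set.Ioo 0 1) {D : Set X} (hD : IsPreconnected D)
    (hcut : ∀ f ∈ F, edge f (r f) ∉ D)
    (hleft : ∀ f ∈ F, ∃ s < r f, edge f s ∈ D) (hright : ∀ f ∈ F, ∃ s, r f < s ∧ edge f s ∈ D) :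
    F.ncard ≤ firstBetti X := by
  classical
  refine ncard_le_firstBetti X F fun f hf => ?_
  set S := (Finsupp.supported ℚ ℚ Fᶜ).map (boundary X) with hS
  -- The value `0` off the vertices is harmless, since `starUnion` tests `P` only at vertices.
  let φ : X → ({v : X // v ∈ (vertices : Finset X)} →₀ ℚ) :=
    fun v => if hv : v ∈ (vertices : Finset X) then Finsupp.single ⟨v, hv⟩ 1 else 0
  have hφ : ∀ g : Edge X, boundary X (Finsupp.single g 1) = φ (edge g 1) - φ (edge g 0) := by
    intro g
    simp only [φ, dif_pos (edge_one_mem g), dif_pos (edge_zero_mem g), boundary_single]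
  have hnot : ∀ g ∉ F, φ (edge g 1) - φ (edge g 0) ∈ S := fun g hg => by
    rw [← hφ]
    exact Submodule.mem_map_of_mem (Finsupp.single_mem_supported ℚ 1 hg)
  -- `P v` says that `v` is homologous to the initial vertex of `f` through edges outside `F`. If it
  -- failed at the final vertex, the two star unions would separate `D`.
  let P : X → Prop := fun v => φ v - φ (edge f 0) ∈ S
  have hPg : ∀ g ∉ F, (P (edge g 0) ↔ P (edge g 1)) := by
    intro g hg
    have h := hnot g hg
    constructor
    · intro h'
      have := S.add_mem h h'
      simpa [P] using this
    · intro h'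
      have := S.sub_mem h' h
      simpa [P] using this
  have hdisj : ∀ x ∈ D, x ∈ starUnion r P → x ∉ starUnion r (fun v => ¬ P v) := by
    intro x hxD hx hx'
    rcases cover x with hv | ⟨g, s, hs, rfl⟩
    · exact of_mem_starUnion_vertex hr hv hx' (of_mem_starUnion_vertex hr hv hx)
    · by_cases hg : g ∈ F
      · have hne : s ≠ r g := by
          rintro rfl
          exact hcut g hg hxD
        rcases of_mem_starUnion_edge hs hx with ⟨h1, h2⟩ | ⟨h1, h2⟩ <;>
          rcases of_mem_starUnion_edge hs hx' with ⟨h3, h4⟩ | ⟨h3, h4⟩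
        · exact h3 h1
        · exact hne (le_antisymm h2 h4)
        · exact hne (le_antisymm h4 h2)
        · exact h3 h1
      · have := hPg g hg
        rcases of_mem_starUnion_edge hs hx with ⟨h1, h2⟩ | ⟨h1, h2⟩ <;>
          rcases of_mem_starUnion_edge hs hx' with ⟨h3, h4⟩ | ⟨h3, h4⟩ <;> tauto
  obtain ⟨s, hs, hsD⟩ := hleft f hf
  obtain ⟨s', hs', hsD'⟩ := hright f hf
  have hP0 : P (edge f 0) := by simp [P]
  rw [hφ]
  change P (edge f 1)
  by_contra hP1
  obtain ⟨x, hxD, hx, hx'⟩ := isPreconnected_closed_iff.1 hD _ _ (isClosed_starUnion r P)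
    (isClosed_starUnion r fun v => ¬ P v) (by rw [starUnion_union_not]; exact Set.subset_univ _)
    ⟨_, hsD, edge_mem_starUnion_left hP0 hs.le⟩
    ⟨_, hsD', edge_mem_starUnion_right (P := fun v => ¬ P v) hP1 hs'.le⟩
  exact hdisj x hxD hx hx'

end Topology

end FiniteTopologicalGraph

/-! ### Arcs in graphs, and chains of Gromov products -/

namespace FiniteTopologicalGraph

section Arcs

variable {X : Type u} [TopologicalSpace X] [FiniteTopologicalGraph X] [T2Space X]

/-- An arc that passes through an interior point of an edge visits both sides of that point. -/
theorem exists_edge_eq_both_sides {σ : ℝ → X} {c d τ : ℝ} (hτ : τ ∈ Set.Ioo c d)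
    (hσ : ContinuousOn σ (Set.Icc c d)) (hinj : Set.InjOn σ (Set.Icc c d)) {e : Edge X}
    {a s b : unitInterval} (ha : a < s) (hb : s < b) (he : edge e s = σ τ) :
    (∃ s' ∈ Set.Ioo a s, ∃ u ∈ Set.Icc c d, u ≠ τ ∧ edge e s' = σ u) ∧
      ∃ s' ∈ Set.Ioo s b, ∃ u ∈ Set.Icc c d, u ≠ τ ∧ edge e s' = σ u := by
  have hστ : ContinuousAt σ τ := hσ.continuousAt (Icc_mem_nhds hτ.1 hτ.2)
  have hnhds : ∀ᶠ u in nhds τ, σ u ∈ edge e '' Set.Ioo a b ∧ u ∈ Set.Icc c d :=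
    (hστ.eventually_mem ((isOpen_image_edge e a b).mem_nhds ⟨s, ⟨ha, hb⟩, he⟩)).and
      (Icc_mem_nhds hτ.1 hτ.2)
  obtain ⟨η, hη, hball⟩ := Metric.eventually_nhds_iff_ball.1 hnhds
  have hK : ∀ u ∈ Set.Icc (τ - η / 2) (τ + η / 2), σ u ∈ edge e '' Set.Ioo a b ∧ u ∈ Set.Icc c d :=
    fun u hu => hball u (by
      rw [Metric.mem_ball, Real.dist_eq, abs_lt]
      constructor <;> linarith [hu.1, hu.2])
  set K := Set.Icc (τ - η / 2) (τ + η / 2) with hKdef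
  have hKcd : K ⊆ Set.Icc c d := fun u hu => (hK u hu).2
  have hex : ∀ u ∈ K, ∃ v ∈ Set.Ioo a b, edge e v = σ u := fun u hu => (hK u hu).1
  choose! h hmem hh using hex
  have hI : ∀ {a' b' v : unitInterval}, v ∈ Set.Ioo a' b' → v ∈ Set.Ioo (0 : unitInterval) 1 :=
    fun h => ⟨lt_of_le_of_lt unitInterval.nonneg' h.1, lt_of_lt_of_le h.2 unitInterval.le_one'⟩
  -- Open subintervals of the edge have open image, so the lift `h` of `σ` is continuous. Being also
  -- injective, it is strictly monotone and passes through `s` from one side to the other.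
  have hpre : ∀ {a' b' : unitInterval}, ∀ u ∈ K, h u ∈ Set.Ioo a' b' →
      ∀ᶠ w in nhdsWithin u K, h w ∈ Set.Ioo a' b' := by
    intro a' b' u hu hu'
    have h1 := (hσ.mono hKcd u hu).eventually_mem
      ((isOpen_image_edge e a' b').mem_nhds ⟨h u, hu', hh u hu⟩)
    filter_upwards [h1, self_mem_nhdsWithin] with w ⟨v, hv, hvw⟩ hw
    rw [← hh w hw] at hvw
    rwa [← (edge_eq_edge_iff (hI hv) hvw).2]
  have hcont : ContinuousOn h K := by
    intro u hu
    refine tendsto_order.2 ⟨fun a' ha' => ?_, fun b' hb' => ?_⟩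
    · exact (hpre u hu ⟨ha', (hmem u hu).2⟩).mono fun w hw => hw.1
    · exact (hpre u hu ⟨(hmem u hu).1, hb'⟩).mono fun w hw => hw.2
  have hhinj : Set.InjOn h K := fun u hu w hw huw =>
    hinj (hKcd hu) (hKcd hw) (by rw [← hh u hu, ← hh w hw, huw])
  have hτK : τ ∈ K := ⟨by linarith, by linarith⟩
  have hlK : τ - η / 2 ∈ K := ⟨by linarith, by linarith⟩
  have hrK : τ + η / 2 ∈ K := ⟨by linarith, by linarith⟩
  have hτs : h τ = s :=
    (edge_eq_edge_iff (hI (hmem τ hτK)) ((hh τ hτK).trans he.symm)).2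
  rcases hcont.strictMonoOn_of_injOn_Icc' (by linarith) hhinj with hm | hm
  · have h1 := hm hlK hτK (by linarith)
    have h2 := hm hτK hrK (by linarith)
    rw [hτs] at h1 h2
    exact ⟨⟨_, ⟨(hmem _ hlK).1, h1⟩, _, hKcd hlK, by linarith, hh _ hlK⟩,
      ⟨_, ⟨h2, (hmem _ hrK).2⟩, _, hKcd hrK, by linarith, hh _ hrK⟩⟩
  · have h1 := hm hlK hτK (by linarith)
    have h2 := hm hτK hrK (by linarith)
    rw [hτs] at h1 h2
    exact ⟨⟨_, ⟨(hmem _ hrK).1, h2⟩, _, hKcd hrK, by linarith, hh _ hrK⟩,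
      ⟨_, ⟨h1, (hmem _ hlK).2⟩, _, hKcd hlK, by linarith, hh _ hlK⟩⟩

/-- If a connected set avoids finitely many points in the interiors of edges, and accumulates at
each of them from both sides, then there are at most `β₁` such points. -/
theorem card_le_firstBetti_of_isPreconnected {ι : Type*} [Finite ι] {q : ι → X}
    (hq : Function.Injective q) (hv : ∀ i, q i ∉ (vertices : Finset X)) {D : Set X}
    (hD : IsPreconnected D) (hqD : ∀ i, q i ∉ D)
    (hside : ∀ i e s, edge e s = q i → ∀ a b, a < s → s < b →
      (∃ s' ∈ Set.Ioo a s, edge e s' ∈ D) ∧ ∃ s' ∈ Set.Ioo s b, edge e s' ∈ D) :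
    Nat.card ι ≤ firstBetti X := by
  classical
  have hex : ∀ i, ∃ e, ∃ s ∈ Set.Ioo (0 : unitInterval) 1, edge e s = q i :=
    fun i => (cover (q i)).resolve_left (hv i)
  choose e s hs he using hex
  -- Two cut points on one edge would trap the connected set `D` in the segment between them,
  -- although `D` also has points beyond `s i`.
  have hlt : ∀ i j, e i = e j → ¬ s i < s j := by
    intro i j hij hlt
    have hj : edge (e i) (s j) = q j := by rw [hij, he]
    obtain ⟨v, hv1, hv2⟩ := (hside i (e i) (s i) (he i) 0 (s j) (hs i).1 hlt).2
    obtain ⟨w, hw1, hw2⟩ := (hside i (e i) (s i) (he i) 0 (s j) (hs i).1 hlt).1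
    have hsub : D ⊆ edge (e i) '' Set.Ioo (s i) (s j) := by
      refine IsPreconnected.subset_left_of_subset_union (isOpen_image_edge _ _ _)
        (v := (edge (e i) '' Set.Icc (s i) (s j))ᶜ)
        (isClosed_Icc.isCompact.image (edge (e i)).continuous).isClosed.isOpen_compl
        (Set.disjoint_compl_right_iff_subset.2 (Set.image_mono Set.Ioo_subset_Icc_self))
        (fun x hx => ?_) ⟨_, hv2, _, hv1, rfl⟩ hD
      by_cases hmem : x ∈ edge (e i) '' Set.Icc (s i) (s j)
      · obtain ⟨u, hu, rfl⟩ := hmem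
        refine Or.inl ⟨u, ⟨lt_of_le_of_ne hu.1 ?_, lt_of_le_of_ne hu.2 ?_⟩, rfl⟩
        · rintro rfl
          exact hqD i (he i ▸ hx)
        · rintro rfl
          exact hqD j (hj ▸ hx)
      · exact Or.inr hmem
    obtain ⟨u, hu, huw⟩ := hsub hw2
    have := (edge_eq_edge_iff ⟨(hs i).1.trans hu.1, hu.2.trans (hs j).2⟩ huw).2
    subst this
    exact absurd hu.1 (not_lt.2 hw1.2.le)
  have hinj : Function.Injective e := by
    intro i j hij
    have : s i = s j := le_antisymm (not_lt.1 (hlt j i hij.symm)) (not_lt.1 (hlt i j hij))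
    exact hq (by rw [← he i, ← he j, hij, this])
  have hhalf : (⟨1 / 2, by norm_num, by norm_num⟩ : unitInterval) ∈ Set.Ioo 0 1 :=
    ⟨Subtype.mk_lt_mk.2 (by norm_num), Subtype.mk_lt_mk.2 (by norm_num)⟩
  -- On the remaining edges any interior parameter serves as cut.
  let r : Edge X → unitInterval := Function.extend e s fun _ => ⟨1 / 2, by norm_num, by norm_num⟩
  have hre : ∀ i, r (e i) = s i := fun i => hinj.extend_apply _ _ i
  have hr : ∀ f, r f ∈ Set.Ioo (0 : unitInterval) 1 := by
    intro f
    by_cases hf : ∃ i, e i = f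
    · obtain ⟨i, rfl⟩ := hf
      rw [hre]
      exact hs i
    · simp only [r, Function.extend_apply' _ _ _ hf]
      exact hhalf
  rw [← Set.ncard_range_of_injective hinj]
  refine ncard_le_firstBetti_of_isPreconnected (Set.range e) r hr hD ?_ ?_ ?_
  · rintro _ ⟨i, rfl⟩
    rw [hre, he]
    exact hqD i
  · rintro _ ⟨i, rfl⟩
    obtain ⟨v, hv, hvD⟩ := (hside i _ _ (he i) 0 1 (hs i).1 (hs i).2).1
    exact ⟨v, hre i ▸ hv.2, hvD⟩
  · rintro _ ⟨i, rfl⟩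
    obtain ⟨v, hv, hvD⟩ := (hside i _ _ (he i) 0 1 (hs i).1 (hs i).2).2
    exact ⟨v, hre i ▸ hv.1, hvD⟩

end Arcs

end FiniteTopologicalGraph

/-! ### Length of minimal chains -/

section Chains

open FiniteTopologicalGraph

variable {G : Type u} [MetricSpace G]

theorem gromovProduct_le_right (p x y : G) : gromovProduct p x y ≤ dist p y := by
  rw [gromovProduct_comm]
  exact gromovProduct_le_left p y x

theorem gromovProduct_nonneg (p x y : G) : 0 ≤ gromovProduct p x y := by
  have := dist_triangle_left x y p
  unfold gromovProduct
  linarith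

/-- In a graph, a chain of points in which consecutive points have Gromov product greater than `t`,
and no two other points do, has at most `2 β₁ + 1` steps. -/
theorem chain_length_le [IsLengthSpace G] [FiniteTopologicalGraph G] (p : G) {t : ℝ} (ht : 0 ≤ t)
    {n : ℕ} {c : ℕ → G} (hc : ∀ i < n, t < gromovProduct p (c i) (c (i + 1)))
    (hshort : ∀ i j, i + 2 ≤ j → j ≤ n → gromovProduct p (c i) (c j) ≤ t) :
    n ≤ 2 * firstBetti G + 1 := by
  rcases Nat.lt_or_ge n 2 with hn | hn
  · omega
  -- All but finitely many heights just above `t` avoid the vertices, so the cut points will be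
  -- interior to edges.
  obtain ⟨T, htT, hTc, hTv⟩ : ∃ T, t < T ∧
      (∀ i ∈ Finset.range n, T < gromovProduct p (c i) (c (i + 1))) ∧
        ∀ v ∈ (vertices : Finset G), T ≠ dist p v := by
    have h1 : ∀ᶠ T in nhdsWithin t (Set.Ioi t),
        ∀ i ∈ Finset.range n, T < gromovProduct p (c i) (c (i + 1)) := by
      rw [Finset.eventually_all]
      exact fun i hi => nhdsWithin_le_nhds (gt_mem_nhds (hc i (Finset.mem_range.1 hi)))
    have h2 : ∀ᶠ T in nhdsWithin t (Set.Ioi t), ∀ v ∈ (vertices : Finset G), T ≠ dist p v := by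
      rw [Finset.eventually_all]
      intro v _
      rcases le_or_gt (dist p v) t with h | h
      · filter_upwards [self_mem_nhdsWithin] with T hT
        exact (lt_of_le_of_lt h hT).ne'
      · filter_upwards [nhdsWithin_le_nhds (gt_mem_nhds h)] with T hT
        exact (show T < dist p v from hT).ne
    exact (eventually_mem_nhdsWithin.and (h1.and h2)).exists
  replace hTc : ∀ i < n, T < gromovProduct p (c i) (c (i + 1)) :=
    fun i hi => hTc i (Finset.mem_range.2 hi)
  have hT0 : 0 < T := ht.trans_lt htT
  have hTd : ∀ k ≤ n, T < dist p (c k) := by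
    intro k hk
    rcases hk.lt_or_eq with h | rfl
    · exact (hTc k h).trans_le (gromovProduct_le_left _ _ _)
    · have := hTc (k - 1) (by omega)
      rw [Nat.sub_add_cancel (by omega)] at this
      exact this.trans_le (gromovProduct_le_right _ _ _)
  choose σ hσ0 hσ1 hσ using fun k => IsLengthSpace.exists_geodesic p (c k)
  have hmem : ∀ k ≤ n, T ∈ Set.Icc 0 (dist p (c k)) := fun k hk => ⟨hT0.le, (hTd k hk).le⟩
  have hσp : ∀ k, ∀ a ∈ Set.Icc 0 (dist p (c k)), dist p (σ k a) = a := by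
    intro k a ha
    have := hσ k 0 ⟨le_rfl, dist_nonneg⟩ a ha
    rwa [hσ0, zero_sub, abs_neg, abs_of_nonneg ha.1] at this
  have hσc : ∀ k, ∀ a ∈ Set.Icc 0 (dist p (c k)), dist (σ k a) (c k) = dist p (c k) - a := by
    intro k a ha
    have := hσ k a ha (dist p (c k)) ⟨dist_nonneg, le_rfl⟩
    rwa [hσ1, abs_sub_comm, abs_of_nonneg (by linarith [ha.2])] at this
  -- Geodesics that meet at height `T` force the Gromov product of their ends to be at least `T >
  -- t`.
  have hne : ∀ i j, i + 2 ≤ j → j ≤ n → σ i T ≠ σ j T := by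
    intro i j hij hj heq
    have h1 := hσc i T (hmem i (by omega))
    have h2 := hσc j T (hmem j hj)
    rw [← heq] at h2
    have h3 := dist_triangle_left (c i) (c j) (σ i T)
    have h4 := hshort i j hij hj
    unfold gromovProduct at h4
    linarith
  -- The indices are `2, 4, …`: pairwise non-consecutive, and far enough from `0` that the geodesic
  -- to `c 0` avoids every cut point.
  let q : Fin (n / 2) → G := fun i => σ (2 * (i + 1)) T
  have hlen : ∀ i : Fin (n / 2), 2 * ((i : ℕ) + 1) ≤ n := fun i => by omega
  have hqT : ∀ i, dist p (q i) = T := fun i => hσp _ T (hmem _ (hlen i))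
  have hqinj : Function.Injective q := by
    intro i j hij
    by_contra hcon
    rcases lt_or_gt_of_ne (fun h => hcon (Fin.ext h) : (i : ℕ) ≠ j) with h | h
    · exact hne _ _ (by omega) (hlen j) hij
    · exact hne _ _ (by omega) (hlen i) hij.symm
  have hcont : ∀ k, ContinuousOn (σ k) (Set.Icc 0 (dist p (c k))) :=
    fun k => continuousOn_of_dist_eq_abs (hσ k)
  set U : Set G := (Set.range q)ᶜ with hU
  have hnU : ∀ {z}, dist p z ≠ T → z ∈ U := by
    rintro z hz ⟨i, rfl⟩
    exact hz (hqT i)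
  have hext : ∀ {A : Set G} {z w : G}, IsPreconnected A → A ⊆ U → z ∈ A → w ∈ A →
      z ∈ connectedComponentIn U p → w ∈ connectedComponentIn U p := by
    intro A z w hA hAU hz hw hzD
    rw [connectedComponentIn_eq hzD]
    exact hA.subset_connectedComponentIn hz hAU hw
  have hpD : p ∈ connectedComponentIn U p :=
    mem_connectedComponentIn (hnU (by rw [dist_self]; exact hT0.ne))
  have hcD : ∀ k ≤ n, c k ∈ connectedComponentIn U p := by
    intro k
    induction k with
    | zero =>
      intro _
      refine hext (A := σ 0 '' Set.Icc 0 (dist p (c 0))) (isPreconnected_Icc.image _ (hcont 0)) ?_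
        ⟨0, ⟨le_rfl, dist_nonneg⟩, hσ0 0⟩ ⟨_, ⟨dist_nonneg, le_rfl⟩, hσ1 0⟩ hpD
      rintro _ ⟨a, ha, rfl⟩
      by_cases haT : a = T
      · rintro ⟨i, hi⟩
        subst haT
        exact hne 0 (2 * (i + 1)) (by omega) (hlen i) hi.symm
      · exact hnU (by rwa [hσp 0 a ha])
    | succ k ih =>
      intro hk
      obtain ⟨τ, hτ0, hτ1, hτ⟩ := IsLengthSpace.exists_geodesic (c k) (c (k + 1))
      refine hext (A := τ '' Set.Icc 0 (dist (c k) (c (k + 1))))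
        (isPreconnected_Icc.image _ (continuousOn_of_dist_eq_abs hτ)) ?_
        ⟨0, ⟨le_rfl, dist_nonneg⟩, hτ0⟩ ⟨_, ⟨dist_nonneg, le_rfl⟩, hτ1⟩ (ih (by omega))
      rintro _ ⟨a, ha, rfl⟩
      -- Every point of a geodesic from `c k` to `c (k + 1)` is at distance at least their Gromov
      -- product from `p`, hence more than `T`.
      refine hnU (ne_of_gt ?_)
      have h1 := hτ 0 ⟨le_rfl, dist_nonneg⟩ a ha
      have h2 := hτ a ha _ ⟨dist_nonneg, le_rfl⟩
      rw [hτ0, zero_sub, abs_neg, abs_of_nonneg ha.1] at h1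
      rw [hτ1, abs_sub_comm, abs_of_nonneg (by linarith [ha.2])] at h2
      have h3 := hTc k (by omega)
      have h4 := dist_triangle_right p (c k) (τ a)
      have h5 := dist_triangle p (τ a) (c (k + 1))
      unfold gromovProduct at h3
      linarith
  have hσD : ∀ k ≤ n, ∀ a ∈ Set.Icc 0 (dist p (c k)), a ≠ T →
      σ k a ∈ connectedComponentIn U p := by
    intro k hk a ha haT
    -- Below height `T` the geodesic is followed from `p`, above it from `c k`; neither piece meets
    -- level `T`.
    rcases lt_or_gt_of_ne haT with h | h
    · refine hext (A := σ k '' Set.Icc 0 a)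
        (isPreconnected_Icc.image _ ((hcont k).mono (Set.Icc_subset_Icc_right ha.2))) ?_
        ⟨0, ⟨le_rfl, ha.1⟩, hσ0 k⟩ ⟨a, ⟨ha.1, le_rfl⟩, rfl⟩ hpD
      rintro _ ⟨b, hb, rfl⟩
      refine hnU ?_
      rw [hσp k b ⟨hb.1, hb.2.trans ha.2⟩]
      exact (hb.2.trans_lt h).ne
    · refine hext (A := σ k '' Set.Icc a (dist p (c k)))
        (isPreconnected_Icc.image _ ((hcont k).mono (Set.Icc_subset_Icc_left ha.1))) ?_
        ⟨_, ⟨ha.2, le_rfl⟩, hσ1 k⟩ ⟨a, ⟨le_rfl, ha.2⟩, rfl⟩ (hcD k hk)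
      rintro _ ⟨b, hb, rfl⟩
      refine hnU ?_
      rw [hσp k b ⟨ha.1.trans hb.1, hb.2⟩]
      exact (h.trans_le hb.1).ne'
  have hcard := card_le_firstBetti_of_isPreconnected hqinj
    (fun i hi => hTv _ hi (hqT i).symm) (isPreconnected_connectedComponentIn (x := p) (F := U))
    (fun i hi => connectedComponentIn_subset _ _ hi ⟨i, rfl⟩) (by
      intro i e s hes a b ha hb
      have hk := hlen i
      have hinj : Set.InjOn (σ (2 * (i + 1))) (Set.Icc 0 (dist p (c (2 * (i + 1))))) := by
        intro u hu w hw huw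
        rw [← hσp _ u hu, ← hσp _ w hw, huw]
      obtain ⟨⟨s₁, h₁, u₁, hu₁, hne₁, he₁⟩, ⟨s₂, h₂, u₂, hu₂, hne₂, he₂⟩⟩ :=
        exists_edge_eq_both_sides ⟨hT0, hTd _ hk⟩ (hcont _) hinj ha hb hes
      exact ⟨⟨s₁, h₁, he₁ ▸ hσD _ hk _ hu₁ hne₁⟩, ⟨s₂, h₂, he₂ ▸ hσD _ hk _ hu₂ hne₂⟩⟩)
  rw [Nat.card_fin] at hcard
  omega

end Chains

/-! ### Comparison of the metric with the Gromov tree metric -/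

section Comparison

open FiniteTopologicalGraph

variable {G : Type u} [MetricSpace G]

theorem hyperbolicity_nonneg (X : Type u) [MetricSpace X] : 0 ≤ hyperbolicity X :=
  Real.sInf_nonneg fun _ h => h.1

/-- For each quadruple the condition is a lower bound on `δ`, so it passes to the infimum.
Boundedness makes the set of admissible `δ` nonempty. -/
theorem isGromovHyperbolic_hyperbolicity (X : Type u) [MetricSpace X] [CompactSpace X] :
    IsGromovHyperbolic X (hyperbolicity X) := by
  have hne : {δ : ℝ | 0 ≤ δ ∧ IsGromovHyperbolic X δ}.Nonempty := by
    refine ⟨Metric.diam (Set.univ : Set X), Metric.diam_nonneg, fun x y z w => ?_⟩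
    have hb : Bornology.IsBounded (Set.univ : Set X) := isCompact_univ.isBounded
    have h1 := Metric.dist_le_diam_of_mem hb (Set.mem_univ x) (Set.mem_univ y)
    have h2 := Metric.dist_le_diam_of_mem hb (Set.mem_univ w) (Set.mem_univ z)
    have h3 : 0 ≤ max (dist x w + dist y z) (dist x z + dist y w) :=
      le_max_of_le_left (by positivity)
    linarith
  intro x y z w
  have h : (dist x y + dist w z - max (dist x w + dist y z) (dist x z + dist y w)) / 2 ≤
      hyperbolicity X :=
    le_csInf hne fun δ hδ => by linarith [hδ.2 x y z w]
  linarith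

theorem IsGromovHyperbolic.min_gromovProduct_le {δ : ℝ} (h : IsGromovHyperbolic G δ)
    (p x y z : G) :
    min (gromovProduct p x y) (gromovProduct p y z) ≤ gromovProduct p x z + δ := by
  have h1 := h x z y p
  unfold gromovProduct
  rw [dist_comm x p, dist_comm z y, dist_comm z p] at h1
  rcases le_total (dist p x + dist y z) (dist x y + dist p z) with h2 | h2
  · rw [max_eq_right h2] at h1
    exact min_le_of_left_le (by linarith)
  · rw [max_eq_left h2] at h1
    exact min_le_of_right_le (by linarith)

/-- Along a chain of at most `2 ^ k` steps, the Gromov product decreases by at most `k δ`. -/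
theorem IsGromovHyperbolic.le_gromovProduct_of_chain {δ : ℝ} (hδ : 0 ≤ δ)
    (h : IsGromovHyperbolic G δ) (p : G) {t : ℝ} (k : ℕ) :
    ∀ (n : ℕ) (c : ℕ → G), n + 1 ≤ 2 ^ k →
      (∀ i < n + 1, t ≤ gromovProduct p (c i) (c (i + 1))) →
        t ≤ gromovProduct p (c 0) (c (n + 1)) + k * δ := by
  induction k with
  | zero =>
    intro n c hn hc
    obtain rfl : n = 0 := by simpa using hn
    simpa using hc 0 one_pos
  | succ k ih =>
    intro n c hn hc
    rw [pow_succ] at hn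
    push_cast
    rcases Nat.lt_or_ge (2 ^ k) (n + 1) with hlt | hle
    · have hk : 0 < 2 ^ k := by positivity
      -- The chain is split after exactly `2 ^ k` steps; combining the two parts costs one more `δ`.
      set a := 2 ^ k - 1 with ha
      have h1 := ih a c (by omega) fun i hi => hc i (by omega)
      have h2 := ih (n - (a + 1)) (fun i => c (a + 1 + i)) (by omega)
        fun i hi => hc (a + 1 + i) (by omega)
      have h3 : a + 1 + (n - (a + 1) + 1) = n + 1 := by omega
      simp only [add_zero, h3] at h2
      have h4 := h.min_gromovProduct_le p (c 0) (c (a + 1)) (c (n + 1))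
      rcases min_le_iff.1 h4 with h5 | h5 <;> linarith
    · have := ih n c hle hc
      linarith

/-- A chain of minimal length. -/
theorem exists_minimal_chain {p x y : G} {t : ℝ} (h : t < gromovProductInf p x y) :
    ∃ (n : ℕ) (c : ℕ → G), c 0 = x ∧ c (n + 1) = y ∧
      (∀ i < n + 1, t < gromovProduct p (c i) (c (i + 1))) ∧
        ∀ i j, i + 2 ≤ j → j ≤ n + 1 → gromovProduct p (c i) (c j) ≤ t := by
  classical
  have hex : ∃ (n : ℕ) (c : ℕ → G), c 0 = x ∧ c (n + 1) = y ∧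
      ∀ i < n + 1, t < gromovProduct p (c i) (c (i + 1)) := by
    obtain ⟨r, ⟨n, c, h0, h1, rfl⟩, hr⟩ :=
      exists_lt_of_lt_csSup ⟨_, gromovProduct_mem_chains p x y⟩ h
    rw [Finset.lt_inf'_iff] at hr
    exact ⟨n, c, h0, h1, fun i hi => hr i (Finset.mem_range.2 hi)⟩
  obtain ⟨c, h0, h1, hc⟩ := Nat.find_spec hex
  refine ⟨Nat.find hex, c, h0, h1, hc, fun i j hij hj => ?_⟩
  by_contra! hcon
  set n := Nat.find hex with hn
  -- Otherwise jumping directly from `c i` to `c j` would give a chain with `j - i - 1` fewer steps.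
  refine Nat.find_min hex (m := n - (j - i - 1)) (by omega)
    ⟨fun l => if l ≤ i then c l else c (l + (j - i - 1)), by simpa using h0, ?_, ?_⟩
  · have h2 : ¬ n - (j - i - 1) + 1 ≤ i := by omega
    have h3 : n - (j - i - 1) + 1 + (j - i - 1) = n + 1 := by omega
    simp only [h2, if_false, h3, h1]
  · intro l hl
    rcases lt_trichotomy l i with hli | rfl | hli
    · have h2 : l ≤ i := hli.le
      have h3 : l + 1 ≤ i := hli
      simp only [h2, h3, if_true]
      exact hc l (by omega)
    · have h3 : ¬ l + 1 ≤ l := by omega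
      have h4 : l + 1 + (j - l - 1) = j := by omega
      simpa only [le_refl, if_true, h3, if_false, h4] using hcon
    · have h2 : ¬ l ≤ i := by omega
      have h3 : ¬ l + 1 ≤ i := by omega
      have h4 : l + 1 + (j - i - 1) = l + (j - i - 1) + 1 := by omega
      simp only [h2, h3, if_false, h4]
      exact hc _ (by omega)

/-- Rounding `2 b + 2` up to a power of two less than doubles it; this is where `4 β₁ + 4` comes
from. -/
theorem clog_le_logb (b : ℕ) :
    (Nat.clog 2 (2 * b + 2) : ℝ) ≤ Real.logb 2 (4 * (b : ℝ) + 4) := by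
  have h1 : 2 ^ (Nat.clog 2 (2 * b + 2)) ≤ 4 * b + 4 := by
    have h2 := Nat.pow_pred_clog_lt_self one_lt_two (show 1 < 2 * b + 2 by omega)
    have h3 : 0 < Nat.clog 2 (2 * b + 2) := Nat.clog_pos one_lt_two (by omega)
    obtain ⟨k, hk⟩ := Nat.exists_eq_succ_of_ne_zero h3.ne'
    rw [hk] at h2 ⊢
    rw [Nat.pred_succ] at h2
    rw [pow_succ]
    omega
  rw [Real.le_logb_iff_rpow_le one_lt_two (by positivity), Real.rpow_natCast]
  exact_mod_cast h1

theorem gromovProductInf_le [IsLengthSpace G] [FiniteTopologicalGraph G] (p x y : G) :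
    gromovProductInf p x y ≤ gromovProduct p x y +
      Real.logb 2 (4 * (firstBetti G : ℝ) + 4) * hyperbolicity G := by
  have hδ := hyperbolicity_nonneg G
  have hlog := clog_le_logb (firstBetti G)
  have hmul := mul_le_mul_of_nonneg_right hlog hδ
  refine le_of_forall_lt_imp_le_of_dense fun t ht => ?_
  -- Negative `t` lie below every Gromov product; the chain bound needs `0 ≤ t`.
  rcases lt_or_ge t 0 with ht0 | ht0
  · have h1 := gromovProduct_nonneg p x y
    have h2 : 0 ≤ (Nat.clog 2 (2 * firstBetti G + 2) : ℝ) * hyperbolicity G := by positivity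
    linarith
  · obtain ⟨n, c, rfl, rfl, hc, hshort⟩ := exists_minimal_chain ht
    have hn := chain_length_le p ht0 hc hshort
    have := (isGromovHyperbolic_hyperbolicity G).le_gromovProduct_of_chain hδ p
      (Nat.clog 2 (2 * firstBetti G + 2)) n c
      ((show n + 1 ≤ 2 * firstBetti G + 2 by omega).trans (Nat.le_pow_clog one_lt_two _))
      fun i hi => (hc i hi).le
    linarith

theorem abs_dist_sub_gromovTreeDist_le [IsLengthSpace G] [FiniteTopologicalGraph G] (p x y : G) :
    |dist x y - gromovTreeDist p x y| ≤
      2 * Real.logb 2 (4 * (firstBetti G : ℝ) + 4) * hyperbolicity G := by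
  have h1 := gromovProductInf_le p x y
  have h2 := gromovProduct_le_inf p x y
  unfold gromovProduct at h1 h2
  unfold gromovTreeDist
  rw [abs_of_nonneg (by linarith)]
  linarith

end Comparison

theorem mainTheorem9 {G : Type u} [MetricSpace G] [IsLengthSpace G] [FiniteTopologicalGraph G]
    (p : G) :
    (∀ x y : G, |dist x y - gromovTreeDist p x y| ≤
      2 * Real.logb 2 (4 * (FiniteTopologicalGraph.firstBetti G : ℝ) + 4) * hyperbolicity G) ∧
    haveI : Nonempty G := ⟨p⟩
    GromovHausdorff.ghDist G (GromovTree p) ≤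
      Real.logb 2 (4 * (FiniteTopologicalGraph.firstBetti G : ℝ) + 4) * hyperbolicity G := by
  refine ⟨abs_dist_sub_gromovTreeDist_le p, ?_⟩
  have : Nonempty G := ⟨p⟩
  -- The distortion enters halved, which removes the factor `2`.
  have h := GromovHausdorff.ghDist_le_of_approx_subsets (X := G) (Y := GromovTree p)
    (s := Set.univ) (fun x => GromovTree.mk p x) (ε₁ := 0) (ε₃ := 0)
    (fun x => ⟨x, Set.mem_univ x, (dist_self x).le⟩)
    (fun z => by
      obtain ⟨x, rfl⟩ := GromovTree.mk_surjective p z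
      exact ⟨⟨x, Set.mem_univ x⟩, (dist_self _).le⟩)
    (fun x y => by
      rw [GromovTree.dist_mk]
      exact abs_dist_sub_gromovTreeDist_le p (x : G) y)
  linarith
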